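/- Let $\mathbb F_q$ be the finite field with $q$ elements, let $p$ be its characteristic, and let $H\neq 1$ be a finite group. Let $e\in\mathbb F_qH$ be an idempotent with $e\neq 1$ such that the left ideal $C=\mathbb F_qHe$ is nonzero. Notation: $\lambda_1(x)$ is the coefficient of $x\in\mathbb F_qH$ at the identity of $H$; $d(C)$ is the minimum Hamming distance of $C$ with respect to the basis $H$; dimensions are over $\mathbb F_q$; a primitive idempotent is a nonzero idempotent that is not a sum of two nonzero orthogonal idempotents. The algebra $\mathbb F_qH$ is called ECID if $\dim \mathbb F_qHf\le p$ for every primitive idempotent $f\in\mathbb F_qH$. The field $\mathbb F_q$ is a splitting field for $H$ if $\operatorname{End}_{\mathbb F_qH}(S)=\mathbb F_q$ for every simple left $\mathbb F_qH$-module $S$. $H'$ is the commutator subgroup of $H$, and for $w\in H/H'$, $t_w$ is the least positive integer $a$ with $w^{q^a}=w$ (it exists when $p\nmid |H|$). Elements of the prime field $\mathbb F_p\subseteq\mathbb F_q$ are regarded as classes of integers modulo $p$. 1. The element $|H|\lambda_1(e)$ lies in $\mathbb F_p$. If $r$ is the least non-negative integer in its class, then there is $k\in\left\{0,\dots,\left\lfloor\frac{|H|-(r+1)}{p}\right\rfloor\right\}$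 such that $$\dim C=r+kp\quad\text{and}\quad \frac{|H|}{r+kp}\le d(C).$$ 2. Suppose $\mathbb F_qH$ is semisimple with Wedderburn–Artin decomposition, as $\mathbb F_q$-algebra, $\mathbb F_qH\cong\left(\bigoplus_{i=1}^{r}K_i\right)\oplus\left(\bigoplus_{j=1}^{s}M_{n_j}(F_j)\right)$, where the $K_i$ and $F_j$ are extension fields of $\mathbb F_q$ and $n_j\ge 2$ for all $j$ ($s=0$ is allowed). Let $w\in H/H'$ have order $\exp(H/H')$ and let $a$ be a positive integer with $t_w\le a$ and $n_j[F_j:\mathbb F_q]\le a$ for all $j$. If $d(C)<\frac{|H|}{a}$, then $e$ is not primitive. In particular, if $\mathbb F_q$ is a splitting field for $H$ and $d(C)<\frac{|H|}{\max\{1,n_1,\dots,n_s\}}$, then $e$ is not primitive. 3. Suppose $\mathbb F_qH$ is ECID, and let $e_1,\dots,e_m$ be pairwise orthogonal primitive idempotents with $e=\sum_{i=1}^m e_i$. Then every $|H|\lambda_1(e_i)$ lies in $\mathbb F_p$; let $r_i$ be the least non-negative integer in its class, and let $J=\{i: r_i=0\}$. Then $$\dim C=\Big(\sum_{i\notin J}r_i\Big)+|J|\,p\quad\text{and}\quad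 \frac{|H|}{\left(\sum_{i\notin J}r_i\right)+|J|\,p}\le d(C).$$ 4. If $\mathbb F_qH$ is ECID and $d(C)<\frac{|H|}{p}$, then $e$ is not primitive. -/

import Mathlib

open scoped MonoidAlgebra

universe u v w₁ w₂

noncomputable section

namespace GroupCode

/-- Hamming weight of an element of the group algebra: the number of nonzero entries of its
coordinate vector with respect to the basis `H`. -/
def weight {F : Type u} [Field F] {H : Type v} (x : F[H]) : ℕ :=
  x.coeff.support.card

/-- Minimum Hamming distance of a group code, i.e. of a (left) ideal: the least value of
`wt (v - w)` for distinct codewords `v`, `w`. It is meaningful for nonzero ideals only. -/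
def minDist {F : Type u} [Field F] {H : Type v} [Group H] (C : Ideal F[H]) : ℕ :=
  sInf {d : ℕ | ∃ v ∈ C, ∃ w ∈ C, v ≠ w ∧ d = weight (v - w)}

/-- The coefficient at the identity element of the group. -/
def coeffOne {F : Type u} [Field F] {H : Type v} [Group H] (x : F[H]) : F :=
  x.coeff 1

/-- The least non-negative integer in the class `x`, when `x` lies in the prime subfield, whose
elements are regarded as classes of integers modulo the characteristic. For `x` outside the
prime subfield no integer maps to `x`, and the value is `0` by convention. -/
def leastResidue {F : Type u} [Field F] (x : F) : ℕ :=
  sInf {n : ℕ | (n : F) = x}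

/-- Primitive idempotents: nonzero idempotents that are not a sum of two nonzero orthogonal
idempotents. -/
def IsPrimitiveIdempotent {A : Type u} [Ring A] (e : A) : Prop :=
  IsIdempotentElem e ∧ e ≠ 0 ∧
    ∀ f g : A, IsIdempotentElem f → IsIdempotentElem g → f * g = 0 → g * f = 0 →
      e = f + g → f = 0 ∨ g = 0

/-- Easily computable dimension (ECD) group codes: left ideals that are generated by an
idempotent and whose dimension is at most the characteristic of the field. -/
def IsECD {F : Type u} [Field F] {H : Type v} [Group H] (C : Ideal F[H]) : Prop :=
  (∃ e : F[H], IsIdempotentElem e ∧ C = Ideal.span {e}) ∧ Module.finrank F C ≤ ringChar F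

/-- Easily computable indecomposable dimension (ECID) group algebras: all principal
indecomposable modules, i.e. all left ideals generated by a primitive idempotent, are ECD. -/
def IsECID (F : Type u) [Field F] (H : Type v) [Group H] : Prop :=
  ∀ f : F[H], IsPrimitiveIdempotent f → IsECD (Ideal.span {f} : Ideal F[H])

/-- The number `t_g`, the least positive integer `a` with `g ^ (q ^ a) = g`. It is the size of
the `q`-orbit of `g` when the order of `g` is coprime to `q`. -/
def qOrbitSize (q : ℕ) {G : Type v} [Group G] (g : G) : ℕ :=
  sInf {a : ℕ | 0 < a ∧ g ^ (q ^ a) = g}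

/-- `F` is a splitting field for `H`: every endomorphism of every simple left module over the
group algebra is multiplication by a scalar of `F`. Every simple module is a quotient of the
group algebra, so this universe level is large enough. -/
def IsSplittingFieldFor (F : Type u) [Field F] (H : Type v) [Group H] : Prop :=
  ∀ (S : Type (max u v)) [AddCommGroup S] [Module F[H] S], IsSimpleModule F[H] S →
    ∀ φ : S →ₗ[F[H]] S, ∃ c : F, ∀ x : S, φ x = algebraMap F F[H] c • x

end GroupCode

end

namespace GroupCode

/-! ### Dimensions of left ideals generated by idempotents. -/

section IdempotentIdeals

variable {F : Type*} {A : Type*} [Field F] [Ring A] [Algebra F A]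

/-! Two facts carry the theorem. First, right multiplication by `e` is a projection onto `C`, so its
trace is the image of `dim C` in `F`; in the basis `H` every diagonal entry is the coefficient of
`e` at 1, so the trace is also `|H| λ₁(e)` (`natCast_finrank_span`). This fixes `dim C` modulo `p`.
Secondly, `|H| ≤ dim C * wt c` for every nonzero `c ∈ C` (`card_le_finrank_mul_weight`), so a small
minimum distance forces a large dimension.

The non-primitivity claims thus need only upper bounds for `dim C` when `e` is primitive. In the
semisimple case such an `e` lies in one Wedderburn factor (`wedderburn_cases`) and has rank one if
that factor is a matrix algebra. A field factor is generated by a character of the abelianization,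
and the order of Frobenius bounds its degree by `t_w`. Over a splitting field the corner of `e` is
scalar, so the coefficient field of its factor is `F`.

In the ECID case primitive idempotents give dimensions between 1 and `p`, which their residues
determine; these add up over an orthogonal decomposition. -/

theorem mem_span_idempotent_iff {e : A} (he : IsIdempotentElem e) {x : A} :
    x ∈ Ideal.span {e} ↔ x * e = x := by
  rw [Ideal.mem_span_singleton']
  constructor
  · rintro ⟨a, rfl⟩
    rw [mul_assoc, he.eq]
  · exact fun h => ⟨x, h⟩

theorem range_mulRight (e : A) :
    LinearMap.range (LinearMap.mulRight F e) = (Ideal.span {e}).restrictScalars F := by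
  ext x
  simp [Ideal.mem_span_singleton']

theorem finrank_range_mulRight (e : A) :
    Module.finrank F (LinearMap.range (LinearMap.mulRight F e)) =
      Module.finrank F (Ideal.span {e} : Ideal A) := by
  rw [range_mulRight]
  rfl

theorem trace_mulRight_idempotent [FiniteDimensional F A] {e : A} (he : IsIdempotentElem e) :
    LinearMap.trace F A (LinearMap.mulRight F e) =
      (Module.finrank F (Ideal.span {e} : Ideal A) : F) := by
  have h : LinearMap.IsProj ((Ideal.span {e} : Ideal A).restrictScalars F)
      (LinearMap.mulRight F e) := by
    refine ⟨fun x => ?_, fun x hx => ?_⟩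
    · simpa using Ideal.mul_mem_left _ x (Ideal.mem_span_singleton_self e)
    · exact (mem_span_idempotent_iff he).1 hx
  rw [h.trace]
  rfl

theorem finrank_span_add [FiniteDimensional F A] {e f : A} (he : IsIdempotentElem e)
    (hf : IsIdempotentElem f) (hef : e * f = 0) (hfe : f * e = 0) :
    Module.finrank F (Ideal.span {e + f} : Ideal A) =
      Module.finrank F (Ideal.span {e} : Ideal A) +
        Module.finrank F (Ideal.span {f} : Ideal A) := by
  have hsum : IsIdempotentElem (e + f) := by
    simp [IsIdempotentElem, mul_add, add_mul, he.eq, hf.eq, hef, hfe]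
  have hsup : (Ideal.span {e + f} : Ideal A).restrictScalars F =
      (Ideal.span {e} : Ideal A).restrictScalars F ⊔
        (Ideal.span {f} : Ideal A).restrictScalars F := by
    ext x
    rw [Submodule.mem_sup]
    simp only [Submodule.restrictScalars_mem]
    constructor
    · intro hx
      rw [mem_span_idempotent_iff hsum, mul_add] at hx
      exact ⟨x * e, Ideal.mul_mem_left _ _ (Ideal.mem_span_singleton_self e),
        x * f, Ideal.mul_mem_left _ _ (Ideal.mem_span_singleton_self f), hx⟩
    · rintro ⟨y, hy, z, hz, rfl⟩
      rw [mem_span_idempotent_iff he] at hy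
      rw [mem_span_idempotent_iff hf] at hz
      rw [mem_span_idempotent_iff hsum, ← hy, ← hz]
      simp [mul_add, add_mul, mul_assoc, he.eq, hf.eq, hef, hfe]
  have hinf : (Ideal.span {e} : Ideal A).restrictScalars F ⊓
        (Ideal.span {f} : Ideal A).restrictScalars F = ⊥ := by
    rw [eq_bot_iff]
    rintro x ⟨hx, hy⟩
    have hx := (mem_span_idempotent_iff he).1 hx
    have hy := (mem_span_idempotent_iff hf).1 hy
    rw [Submodule.mem_bot, ← hx, ← hy, mul_assoc, hfe, mul_zero]
  have h := Submodule.finrank_sup_add_finrank_inf_eq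
    ((Ideal.span {e} : Ideal A).restrictScalars F) ((Ideal.span {f} : Ideal A).restrictScalars F)
  rw [← hsup, hinf, finrank_bot, add_zero] at h
  exact h

theorem finrank_span_sum [FiniteDimensional F A] {ι : Type*} (s : Finset ι) (ε : ι → A)
    (hid : ∀ i, IsIdempotentElem (ε i)) (horth : ∀ i j, i ≠ j → ε i * ε j = 0) :
    IsIdempotentElem (∑ i ∈ s, ε i) ∧
    Module.finrank F (Ideal.span {∑ i ∈ s, ε i} : Ideal A) =
      ∑ i ∈ s, Module.finrank F (Ideal.span {ε i} : Ideal A) := by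
  classical
  induction s using Finset.induction_on with
  | empty =>
    refine ⟨by simp [IsIdempotentElem], ?_⟩
    rw [← finrank_range_mulRight (F := F), Finset.sum_empty, LinearMap.mulRight_zero_eq_zero,
      LinearMap.range_zero, finrank_bot, Finset.sum_empty]
  | insert i s his ih =>
    have h1 : ε i * ∑ j ∈ s, ε j = 0 := by
      rw [Finset.mul_sum]
      exact Finset.sum_eq_zero fun j hj => horth i j (by rintro rfl; exact his hj)
    have h2 : (∑ j ∈ s, ε j) * ε i = 0 := by
      rw [Finset.sum_mul]
      exact Finset.sum_eq_zero fun j hj => horth j i (by rintro rfl; exact his hj)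
    rw [Finset.sum_insert his, Finset.sum_insert his]
    refine ⟨?_, by rw [finrank_span_add (hid i) ih.1 h1 h2, ih.2]⟩
    simp [IsIdempotentElem, mul_add, add_mul, (hid i).eq, ih.1.eq, h1, h2]

theorem finrank_span_lt [FiniteDimensional F A] {e : A} (he : IsIdempotentElem e) (he1 : e ≠ 1) :
    Module.finrank F (Ideal.span {e} : Ideal A) < Module.finrank F A := by
  refine Submodule.finrank_lt (s := (Ideal.span {e} : Ideal A).restrictScalars F) fun h => he1 ?_
  have h1 : (1 : A) ∈ (Ideal.span {e} : Ideal A).restrictScalars F := h ▸ Submodule.mem_top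
  simpa using (mem_span_idempotent_iff he).1 h1

theorem finrank_span_pos [FiniteDimensional F A] {e : A} (he : e ≠ 0) :
    0 < Module.finrank F (Ideal.span {e} : Ideal A) := by
  have : Nontrivial ((Ideal.span {e} : Ideal A).restrictScalars F) :=
    ⟨⟨e, Ideal.mem_span_singleton_self e⟩, 0, fun h => he (congrArg Subtype.val h)⟩
  exact Module.finrank_pos (R := F) (M := (Ideal.span {e} : Ideal A).restrictScalars F)

end IdempotentIdeals

/-! ### Trace, weight and dimension in the group algebra. -/

section GroupAlgebra

variable {F : Type*} {H : Type*} [Field F] [Group H]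

instance finiteDimensional_monoidAlgebra [Finite H] : FiniteDimensional F F[H] :=
  Module.Finite.of_basis (MonoidAlgebra.basis H F)

theorem finrank_monoidAlgebra {F H : Type*} [Field F] [Finite H] : Module.finrank F F[H] = Nat.card H :=
  Module.finrank_eq_nat_card_basis (MonoidAlgebra.basis H F)

theorem trace_mulRight [Finite H] (x : F[H]) :
    LinearMap.trace F F[H] (LinearMap.mulRight F x) = (Nat.card H : F) * coeffOne x := by
  classical
  have := Fintype.ofFinite H
  rw [LinearMap.trace_eq_matrix_trace F (MonoidAlgebra.basis H F), Matrix.trace]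
  have h : ∀ g : H, (LinearMap.toMatrix (MonoidAlgebra.basis H F) (MonoidAlgebra.basis H F)
      (LinearMap.mulRight F x)).diag g = coeffOne x := by
    intro g
    rw [Matrix.diag_apply, LinearMap.toMatrix_apply, LinearMap.mulRight_apply,
      MonoidAlgebra.basis_apply]
    change (MonoidAlgebra.single g 1 * x).coeff g = x.coeff 1
    rw [MonoidAlgebra.coeff_single_mul_apply]
    simp
  rw [Finset.sum_congr rfl fun g _ => h g]
  simp

/-- The dimension of a left ideal generated by an idempotent, modulo the characteristic. -/
theorem natCast_finrank_span [Finite H] {e : F[H]} (he : IsIdempotentElem e) :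
    (Module.finrank F (Ideal.span {e} : Ideal F[H]) : F) = (Nat.card H : F) * coeffOne e := by
  rw [← trace_mulRight_idempotent he, trace_mulRight]

/-- The supports of the translates of a nonzero codeword cover the group, so that the product of
its weight with the dimension of the code is at least the order of the group. -/
theorem card_le_finrank_mul_weight [Finite H] (C : Ideal F[H]) {c : F[H]} (hc : c ∈ C)
    (hc0 : c ≠ 0) : Nat.card H ≤ Module.finrank F C * weight c := by
  classical
  have := Fintype.ofFinite H
  let τ : H → F[H] := fun h => MonoidAlgebra.single h 1 * c
  -- A basis of the span of all translates, chosen among the translates: at most `dim C` of them.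
  obtain ⟨b, hbs, hspan, hli⟩ := exists_linearIndependent F (Set.range τ)
  have hbfin : b.Finite := (Set.finite_range τ).subset hbs
  have hbC : b ⊆ (C.restrictScalars F : Submodule F F[H]) := by
    intro x hx
    obtain ⟨h, rfl⟩ := hbs hx
    exact C.mul_mem_left _ hc
  have hweight : ∀ x ∈ hbfin.toFinset, x.coeff.support.card ≤ weight c := by
    intro x hx
    obtain ⟨h, rfl⟩ := hbs (hbfin.mem_toFinset.1 hx)
    refine Finset.card_le_card_of_injOn (fun g => h⁻¹ * g) ?_ ?_
    · intro g hg
      simpa [τ, MonoidAlgebra.coeff_single_mul_apply] using hg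
    · intro g _ g' _ hgg
      simpa using hgg
  -- If all of `b` vanished at `g`, so would every translate of `c`; but translating a support point
  -- `s` of `c` by `g * s⁻¹` moves it to `g`.
  have hcover : (Finset.univ : Finset H) ⊆ hbfin.toFinset.biUnion fun x => x.coeff.support := by
    intro g _
    by_contra hg
    obtain ⟨s, hs⟩ : ∃ s, c.coeff s ≠ 0 := by
      by_contra! h
      exact hc0 (MonoidAlgebra.ext (Finsupp.ext h))
    have hle : Submodule.span F b ≤ MonoidAlgebra.supported F F {g}ᶜ := by
      rw [Submodule.span_le]
      intro x hx
      rw [SetLike.mem_coe, MonoidAlgebra.mem_supported']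
      intro m hm
      obtain rfl : m = g := by simpa using hm
      by_contra hne
      exact hg (Finset.mem_biUnion.2 ⟨x, hbfin.mem_toFinset.2 hx, Finsupp.mem_support_iff.2 hne⟩)
    have hmem : τ (g * s⁻¹) ∈ MonoidAlgebra.supported F F {g}ᶜ := by
      apply hle
      rw [hspan]
      exact Submodule.subset_span ⟨_, rfl⟩
    rw [MonoidAlgebra.mem_supported'] at hmem
    apply hs
    simpa [τ, MonoidAlgebra.coeff_single_mul_apply] using hmem g (by simp)
  have hcard : hbfin.toFinset.card ≤ Module.finrank F C := by
    have := hbfin.fintype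
    rw [hbfin.toFinset_eq_toFinset, ← finrank_span_set_eq_card hli]
    exact Submodule.finrank_mono (t := C.restrictScalars F) (Submodule.span_le.2 hbC)
  calc Nat.card H = (Finset.univ : Finset H).card := by simp
    _ ≤ _ := Finset.card_le_card hcover
    _ ≤ hbfin.toFinset.card * weight c := Finset.card_biUnion_le_card_mul _ _ _ hweight
    _ ≤ _ := Nat.mul_le_mul_right _ hcard

theorem minDist_bound [Finite H] {C : Ideal F[H]} (hC : C ≠ ⊥) {n : ℕ}
    (hn : Module.finrank F C ≤ n) : (Nat.card H : ℚ) / (n : ℚ) ≤ (minDist C : ℚ) := by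
  obtain ⟨c, hc, hc0⟩ := Submodule.exists_mem_ne_zero_of_ne_bot hC
  -- As `C ≠ ⊥`, the set of distances is nonempty and its infimum is attained, not the default 0.
  obtain ⟨x, hx, y, hy, hxy, hd⟩ := Nat.sInf_mem
    (s := {d : ℕ | ∃ v ∈ C, ∃ w ∈ C, v ≠ w ∧ d = weight (v - w)}) ⟨_, c, hc, 0, C.zero_mem, hc0, rfl⟩
  have h := card_le_finrank_mul_weight C (C.sub_mem hx hy) (sub_ne_zero.2 hxy)
  have h' : Nat.card H ≤ n * minDist C := by
    rw [minDist, hd]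
    exact h.trans (Nat.mul_le_mul_right _ hn)
  refine div_le_of_le_mul₀ (by positivity) (by positivity) ?_
  rw [mul_comm]
  exact_mod_cast h'

theorem leastResidue_natCast {F : Type*} [Field F] (p : ℕ) [CharP F p] (n : ℕ) :
    leastResidue (n : F) = n % p := by
  refine le_antisymm (Nat.sInf_le ?_) (le_csInf ⟨n, rfl⟩ ?_)
  · change ((n % p : ℕ) : F) = n
    rw [CharP.natCast_eq_natCast F p]
    exact Nat.mod_modEq n p
  · intro m hm
    rw [Set.mem_ofPred_eq, CharP.natCast_eq_natCast F p] at hm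
    rw [← hm]
    exact Nat.mod_le m p

end GroupAlgebra

end GroupCode

namespace GroupCode

/-! ### Idempotents under injections, isomorphisms and products. -/

section Transfer

variable {F : Type*} [Field F] {A : Type*} [Ring A] [Algebra F A] {B : Type*} [Ring B] [Algebra F B]

/-- The corner ring of `e` consists of the scalar multiples of `e`. -/
def HasScalarCorner (F : Type*) [Field F] {A : Type*} [Ring A] [Algebra F A] (e : A) : Prop :=
  ∀ y : A, e * y * e = y → ∃ c : F, y = c • e

/-- The map need not be unital, so this covers the inclusion of a factor into a product as well as
the inverse of an isomorphism. -/
theorem IsPrimitiveIdempotent.of_map {ι : A →ₙₐ[F] B} (hι : Function.Injective ι) {x : A}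
    (h : IsPrimitiveIdempotent (ι x)) : IsPrimitiveIdempotent x := by
  obtain ⟨h1, h2, h3⟩ := h
  refine ⟨hι ?_, fun hx => h2 (by rw [hx, map_zero]), fun f g hf hg hfg hgf hx => ?_⟩
  · rw [map_mul]
    exact h1
  · have := h3 (ι f) (ι g) (hf.map ι) (hg.map ι) (by rw [← map_mul, hfg, map_zero])
      (by rw [← map_mul, hgf, map_zero]) (by rw [hx, map_add])
    simpa only [map_eq_zero_iff ι hι] using this

theorem HasScalarCorner.of_map {ι : A →ₙₐ[F] B} (hι : Function.Injective ι) {x : A}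
    (h : HasScalarCorner F (ι x)) : HasScalarCorner F x := by
  intro y hy
  obtain ⟨c, hc⟩ := h (ι y) (by rw [← map_mul, ← map_mul, hy])
  exact ⟨c, hι (by rw [hc, map_smul])⟩

theorem finrank_span_map_le [FiniteDimensional F A] {ι : A →ₙₐ[F] B} {x : A}
    (h : ∀ b, ∃ a, b * ι x = ι (a * x)) :
    Module.finrank F (Ideal.span {ι x} : Ideal B) ≤ Module.finrank F (Ideal.span {x} : Ideal A) := by
  rw [← finrank_range_mulRight, ← finrank_range_mulRight]
  refine le_trans (Submodule.finrank_mono (t := (LinearMap.range (LinearMap.mulRight F x)).map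
    (ι : A →ₗ[F] B)) ?_) (Submodule.finrank_map_le _ _)
  rintro _ ⟨b, rfl⟩
  obtain ⟨a, ha⟩ := h b
  exact ⟨a * x, ⟨a, rfl⟩, ha.symm⟩

theorem coe_symm_nonUnitalAlgHom (φ : A ≃ₐ[F] B) (e : A) :
    ((φ.symm : B →ₐ[F] A) : B →ₙₐ[F] A) (φ e) = e :=
  φ.symm_apply_apply e

theorem IsPrimitiveIdempotent.map_algEquiv {e : A} (he : IsPrimitiveIdempotent e) (φ : A ≃ₐ[F] B) :
    IsPrimitiveIdempotent (φ e) := by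
  refine IsPrimitiveIdempotent.of_map (ι := ((φ.symm : B →ₐ[F] A) : B →ₙₐ[F] A))
    φ.symm.injective ?_
  rwa [coe_symm_nonUnitalAlgHom]

theorem HasScalarCorner.map_algEquiv {e : A} (he : HasScalarCorner F e) (φ : A ≃ₐ[F] B) :
    HasScalarCorner F (φ e) := by
  refine HasScalarCorner.of_map (ι := ((φ.symm : B →ₐ[F] A) : B →ₙₐ[F] A))
    φ.symm.injective ?_
  rwa [coe_symm_nonUnitalAlgHom]

theorem finrank_span_le_map_algEquiv [FiniteDimensional F A] (e : A) (φ : A ≃ₐ[F] B) :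
    Module.finrank F (Ideal.span {e} : Ideal A) ≤ Module.finrank F (Ideal.span {φ e} : Ideal B) := by
  have := Module.Finite.equiv φ.toLinearEquiv
  have h := finrank_span_map_le (ι := ((φ.symm : B →ₐ[F] A) : B →ₙₐ[F] A)) (x := φ e)
    fun b => ⟨φ b, by
      rw [map_mul]
      exact congrArg (· * _) (φ.symm_apply_apply b).symm⟩
  rwa [coe_symm_nonUnitalAlgHom] at h

/-- The inclusion of a factor into a product of algebras. -/
def singleNonUnitalAlgHom (F : Type*) [Field F] {ι : Type*} [DecidableEq ι] (R : ι → Type*)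
    [∀ i, Ring (R i)] [∀ i, Algebra F (R i)] (i : ι) : R i →ₙₐ[F] (∀ i, R i) where
  toFun := Pi.single i
  map_smul' c x := Pi.single_smul i c x
  map_zero' := Pi.single_zero i
  map_add' x y := Pi.single_add i x y
  map_mul' x y := Pi.single_mul i x y

theorem IsPrimitiveIdempotent.eq_single {ι : Type*} [DecidableEq ι] {R : ι → Type*}
    [∀ i, Ring (R i)] {e : ∀ i, R i} (he : IsPrimitiveIdempotent e) :
    ∃ i, e = Pi.single i (e i) := by
  obtain ⟨h1, h2, h3⟩ := he
  obtain ⟨i, hi⟩ := Function.ne_iff.1 h2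
  have hid : ∀ j, e j * e j = e j := fun j => congrFun h1 j
  refine ⟨i, ?_⟩
  -- Split off one nonzero component; primitivity kills the rest.
  have h := h3 (Pi.single i (e i)) (Function.update e i 0) ?_ ?_ ?_ ?_ ?_
  · rcases h with h | h
    · exact absurd (by simpa using congrFun h i) hi
    · ext j
      by_cases hj : j = i
      · subst hj; simp
      · simpa [hj] using congrFun h j
  all_goals
    try unfold IsIdempotentElem
    ext j
    by_cases hj : j = i
    · subst hj; simp [hid]
    · simp [hj, hid]

theorem IsPrimitiveIdempotent.eq_inl_or_inr {e : A × B} (he : IsPrimitiveIdempotent e) :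
    e = (e.1, 0) ∨ e = (0, e.2) := by
  obtain ⟨h1, -, h3⟩ := he
  have hid1 : e.1 * e.1 = e.1 := congrArg Prod.fst h1
  have hid2 : e.2 * e.2 = e.2 := congrArg Prod.snd h1
  rcases h3 (e.1, 0) (0, e.2) (by ext <;> simp [hid1]) (by ext <;> simp [hid2])
    (by ext <;> simp) (by ext <;> simp) (by ext <;> simp) with h | h
  · exact .inr (by ext <;> simp_all)
  · exact .inl (by ext <;> simp_all)

end Transfer

/-! ### Primitive idempotents in fields and matrix algebras. -/

section Components

variable {F : Type*} [Field F]

/-- A nonzero row `v` of `e` satisfies `v e = v`. With `v ⬝ᵥ u = 1`, the rank-one matrix `f = (e u)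
v` is a nonzero idempotent with `e f = f e = f`, so `e = f + (e - f)` forces `e = f`. -/
theorem IsPrimitiveIdempotent.exists_vecMulVec {L : Type*} [Field L] {n : Type*} [Fintype n]
    [DecidableEq n] {e : Matrix n n L} (he : IsPrimitiveIdempotent e) :
    ∃ u v : n → L, e = Matrix.vecMulVec u v := by
  obtain ⟨h1, h2, h3⟩ := he
  obtain ⟨i, hi⟩ : ∃ i, e i ≠ 0 := Function.ne_iff.1 h2
  obtain ⟨k, hk⟩ : ∃ k, e i k ≠ 0 := Function.ne_iff.1 hi
  set v : n → L := e i with hv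
  have hve : Matrix.vecMul v e = v := by
    have := congrFun h1.eq i
    rwa [Matrix.mul_apply_eq_vecMul] at this
  set u : n → L := Pi.single k (e i k)⁻¹ with hu
  have hvu : v ⬝ᵥ u = 1 := by
    rw [hu, dotProduct_single, mul_inv_cancel₀ hk]
  set f := Matrix.vecMulVec (e.mulVec u) v with hf
  have hef : e * f = f := by
    rw [hf, Matrix.mul_vecMulVec, Matrix.mulVec_mulVec, h1.eq]
  have hfe : f * e = f := by
    rw [hf, Matrix.vecMulVec_mul, hve]
  have hff : f * f = f := by
    nth_rewrite 2 [hf]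
    rw [Matrix.mul_vecMulVec, hf, Matrix.vecMulVec_mulVec, Matrix.dotProduct_mulVec, hve, hvu]
    simp
  have hf0 : f ≠ 0 := by
    intro h
    have : Matrix.vecMul v f = v := by
      rw [hf, Matrix.vecMul_vecMulVec, Matrix.dotProduct_mulVec, hve, hvu, one_smul]
    rw [h, Matrix.vecMul_zero] at this
    exact hi this.symm
  refine ⟨e.mulVec u, v, ?_⟩
  rcases h3 f (e - f) hff (by simp [IsIdempotentElem, mul_sub, sub_mul, h1.eq, hef, hfe, hff])
    (by simp [mul_sub, hfe, hff]) (by simp [sub_mul, hef, hff]) (by simp) with h | h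
  · exact absurd h hf0
  · exact sub_eq_zero.1 h

theorem IsPrimitiveIdempotent.finrank_span_matrix_le {L : Type*} [Field L] [Algebra F L]
    [FiniteDimensional F L] {n : Type*} [Fintype n] [DecidableEq n]
    {e : Matrix n n L} (he : IsPrimitiveIdempotent e) :
    Module.finrank F (Ideal.span {e} : Ideal (Matrix n n L)) ≤
      Fintype.card n * Module.finrank F L := by
  obtain ⟨u, v, rfl⟩ := he.exists_vecMulVec
  let T : (n → L) →ₗ[F] Matrix n n L :=
    { toFun := fun x => Matrix.vecMulVec x v
      map_add' := fun x y => Matrix.add_vecMulVec x y v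
      map_smul' := fun c x => Matrix.smul_vecMulVec c x v }
  have hT : Module.finrank F (n → L) = Fintype.card n * Module.finrank F L := by
    simp [Module.finrank_pi_fintype]
  rw [← finrank_range_mulRight, ← hT]
  refine le_trans (Submodule.finrank_mono (t := LinearMap.range T) ?_) (LinearMap.finrank_range_le T)
  rintro _ ⟨x, rfl⟩
  exact ⟨x.mulVec u, by simp [T, Matrix.mul_vecMulVec]⟩

theorem finrank_eq_one_of_smul {L A : Type*} [Field L] [Algebra F L] [Ring A] [Algebra F A]
    [Module L A] [IsScalarTower F L A] {e : A} (he0 : e ≠ 0)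
    (h : ∀ c : L, ∃ d : F, c • e = d • e) : Module.finrank F L = 1 := by
  refine finrank_eq_one (1 : L) one_ne_zero fun c => ?_
  obtain ⟨d, hd⟩ := h c
  refine ⟨d, ?_⟩
  have : (d • (1 : L) - c) • e = 0 := by
    rw [sub_smul, smul_assoc, one_smul, hd, sub_self]
  exact sub_eq_zero.1 ((smul_eq_zero.1 this).resolve_right he0)

theorem HasScalarCorner.finrank_matrix {L : Type*} [Field L] [Algebra F L] {n : Type*} [Fintype n]
    [DecidableEq n] {e : Matrix n n L} (he : HasScalarCorner F e) (hid : IsIdempotentElem e)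
    (he0 : e ≠ 0) : Module.finrank F L = 1 :=
  finrank_eq_one_of_smul he0 fun c => he (c • e) (by simp [hid.eq])

theorem HasScalarCorner.finrank_field {L : Type*} [Field L] [Algebra F L] {e : L}
    (he : HasScalarCorner F e) (hid : IsIdempotentElem e)
    (he0 : e ≠ 0) : Module.finrank F L = 1 :=
  finrank_eq_one_of_smul he0 fun c => he (c • e) (by
    rw [smul_eq_mul, mul_left_comm, hid.eq, mul_assoc, hid.eq])

variable {r s : ℕ} {K : Fin r → Type w₁} [∀ i, Field (K i)] [∀ i, Algebra F (K i)]
  {L : Fin s → Type w₂} [∀ j, Field (L j)] [∀ j, Algebra F (L j)] {n : Fin s → ℕ}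

/-- A primitive idempotent of a product of fields and matrix algebras lives in one factor. -/
theorem IsPrimitiveIdempotent.wedderburn_cases
    [∀ i, FiniteDimensional F (K i)] [∀ j, FiniteDimensional F (L j)]
    {e : (∀ i, K i) × (∀ j, Matrix (Fin (n j)) (Fin (n j)) (L j))}
    (he : IsPrimitiveIdempotent e) :
    (∃ i, Module.finrank F (Ideal.span {e}) ≤ Module.finrank F (K i) ∧
      (HasScalarCorner F e → Module.finrank F (K i) = 1)) ∨
    (∃ j, Module.finrank F (Ideal.span {e}) ≤ n j * Module.finrank F (L j) ∧
      (HasScalarCorner F e → Module.finrank F (L j) = 1)) := by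
  rcases he.eq_inl_or_inr with h | h
  · left
    let ι := NonUnitalAlgHom.inl F (∀ i, K i) (∀ j, Matrix (Fin (n j)) (Fin (n j)) (L j))
    have hι : Function.Injective ι := fun a b h => congrArg Prod.fst h
    generalize e.1 = x at h
    change e = ι x at h
    subst h
    have hx := he.of_map hι
    obtain ⟨i, hi⟩ := hx.eq_single
    generalize x i = y at hi
    have hσ : Function.Injective (singleNonUnitalAlgHom F K i) := Pi.single_injective i
    change x = singleNonUnitalAlgHom F K i y at hi
    subst hi
    have hy := hx.of_map hσ
    refine ⟨i, ?_, fun hc => ((hc.of_map hι).of_map hσ).finrank_field hy.1 hy.2.1⟩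
    refine (finrank_span_map_le fun b => ⟨b.1, by ext <;> simp [ι]⟩).trans ?_
    refine (finrank_span_map_le fun b => ⟨b i, ?_⟩).trans ?_
    · change b * Pi.single i y = Pi.single i (b i * y)
      exact (Pi.single_mul_right _).symm
    · exact Submodule.finrank_le ((Ideal.span {y}).restrictScalars F)
  · right
    let ι := NonUnitalAlgHom.inr F (∀ i, K i) (∀ j, Matrix (Fin (n j)) (Fin (n j)) (L j))
    have hι : Function.Injective ι := fun a b h => congrArg Prod.snd h
    generalize e.2 = x at h
    change e = ι x at h
    subst h
    have hx := he.of_map hι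
    obtain ⟨j, hj⟩ := hx.eq_single
    generalize x j = y at hj
    have hσ : Function.Injective
      (singleNonUnitalAlgHom F (fun j => Matrix (Fin (n j)) (Fin (n j)) (L j)) j) :=
        Pi.single_injective (M := fun j => Matrix (Fin (n j)) (Fin (n j)) (L j)) j
    change x = singleNonUnitalAlgHom F (fun j => Matrix (Fin (n j)) (Fin (n j)) (L j)) j y at hj
    subst hj
    have hy := hx.of_map hσ
    refine ⟨j, ?_, fun hc => ((hc.of_map hι).of_map hσ).finrank_matrix hy.1 hy.2.1⟩
    refine (finrank_span_map_le fun b => ⟨b.2, by ext <;> simp [ι]⟩).trans ?_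
    refine (finrank_span_map_le fun b => ⟨b j, ?_⟩).trans ?_
    · change b * Pi.single j y = Pi.single j (b j * y)
      exact (Pi.single_mul_right _).symm
    · simpa using hy.finrank_span_matrix_le (F := F)

end Components

end GroupCode

namespace GroupCode

/-! ### Semisimple group algebras: field quotients and simple ideals. -/

section Semisimple

variable {F : Type u} [Field F]

/-- The converse of Maschke's theorem: the sum of all group elements is central, and it is
nilpotent when the characteristic divides the order of the group. -/
theorem natCast_card_ne_zero_of_isSemisimpleRing {H : Type v} [Group H] [Finite H]
    [IsSemisimpleRing F[H]] : (Nat.card H : F) ≠ 0 := by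
  classical
  have := Fintype.ofFinite H
  intro hcard
  set N : F[H] := ∑ h : H, MonoidAlgebra.single h 1 with hN
  have hNcoeff : ∀ g, N.coeff g = 1 := by
    intro g
    simp [hN, Finsupp.finsetSum_apply, Finsupp.single_apply]
  have hcomm : ∀ x : F[H], Commute N x := by
    intro x
    induction x using MonoidAlgebra.induction_on with
    | of g =>
      ext h
      rw [MonoidAlgebra.of_apply, MonoidAlgebra.coeff_mul_single_apply,
        MonoidAlgebra.coeff_single_mul_apply]
      simp [hNcoeff]
    | add x y hx hy => exact hx.add_right hy
    | smul c x hx => exact hx.smul_right c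
  have hNN : N * N = 0 := by
    nth_rewrite 1 [hN]
    ext g
    rw [Finset.sum_mul, MonoidAlgebra.coeff_sum, Finsupp.finsetSum_apply]
    simp_rw [MonoidAlgebra.coeff_single_mul_apply, hNcoeff]
    simpa [Nat.card_eq_fintype_card] using hcard
  obtain ⟨D, hD⟩ := exists_isCompl (Ideal.span {N} : Ideal F[H])
  obtain ⟨a, ha, d, hd, had⟩ := Submodule.mem_sup.1
    (show (1 : F[H]) ∈ (Ideal.span {N} : Ideal F[H]) ⊔ D by rw [hD.sup_eq_top]; trivial)
  obtain ⟨x, rfl⟩ := Ideal.mem_span_singleton'.1 ha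
  -- Write `1 = x N + d` with `d ∈ D`. Since `N` is central with square zero, `N = N d` lies in `D`
  -- as well as in its complement, so `N = 0`.
  have h1 : N = N * d := by
    have : N * (x * N) = 0 := by rw [← mul_assoc, (hcomm x).eq, mul_assoc, hNN, mul_zero]
    calc N = N * (x * N + d) := by rw [had, mul_one]
      _ = N * d := by rw [mul_add, this, zero_add]
  have h2 : N ∈ (Ideal.span {N} : Ideal F[H]) ⊓ D :=
    ⟨Ideal.mem_span_singleton_self N, by rw [h1]; exact Ideal.mul_mem_left D _ hd⟩
  rw [hD.inf_eq_bot, Submodule.mem_bot] at h2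
  simpa [h2] using hNcoeff 1

/-- The order of `w` is prime to `q`, so Euler's theorem supplies an exponent and the infimum is
attained. -/
theorem qOrbitSize_spec [Finite F] {G : Type v} [Group G] [Finite G] (hG : (Nat.card G : F) ≠ 0)
    (w : G) : 0 < qOrbitSize (Nat.card F) w ∧ w ^ Nat.card F ^ qOrbitSize (Nat.card F) w = w := by
  refine Nat.sInf_mem (s := {a : ℕ | 0 < a ∧ w ^ (Nat.card F ^ a) = w})
    ⟨(orderOf w).totient, Nat.totient_pos.2 (orderOf_pos w), ?_⟩
  have := Fintype.ofFinite F
  obtain ⟨p, _⟩ := CharP.exists F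
  obtain ⟨n, hp, hn⟩ := FiniteField.card F p
  have hcop : Nat.Coprime (Nat.card F) (orderOf w) := by
    rw [Nat.card_eq_fintype_card, hn]
    refine Nat.Coprime.pow_left _ ((Nat.Prime.coprime_iff_not_dvd hp).2 fun h => hG ?_)
    exact (CharP.cast_eq_zero_iff F p _).2 (h.trans (orderOf_dvd_natCard w))
  have := Nat.ModEq.pow_totient hcop
  rw [← pow_eq_pow_iff_modEq, pow_one] at this
  exact this

/-- A field that is a quotient of the group algebra is generated by roots of unity of order
dividing the exponent of the abelianization. -/
theorem finrank_field_le_qOrbitSize [Finite F] {H : Type v} [Group H] [Finite H]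
    (hH : (Nat.card H : F) ≠ 0) {K : Type w₁} [Field K] [Algebra F K] (φ : F[H] →ₐ[F] K)
    (hφ : Function.Surjective φ) (w : Abelianization H)
    (hw : orderOf w = Monoid.exponent (Abelianization H)) :
    Module.finrank F K ≤ qOrbitSize (Nat.card F) w := by
  have := Fintype.ofFinite F
  have : FiniteDimensional F K := Module.Finite.of_surjective φ.toLinearMap hφ
  have : Finite K := Module.finite_of_finite F
  have hab : (Nat.card (Abelianization H) : F) ≠ 0 := by
    intro h
    obtain ⟨m, hm⟩ := Subgroup.card_quotient_dvd_card (commutator H)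
    apply hH
    rw [hm, Nat.cast_mul]
    exact mul_eq_zero_of_left h _
  obtain ⟨hpos, hfix⟩ := qOrbitSize_spec (F := F) hab w
  set t := qOrbitSize (Nat.card F) w
  -- The order of `w` is the exponent, so the congruence `q ^ t ≡ 1` holds modulo the order of every
  -- `g`.
  have hall : ∀ g : Abelianization H, g ^ Nat.card F ^ t = g := by
    intro g
    have h : w ^ Nat.card F ^ t = w ^ 1 := by rw [hfix, pow_one]
    rw [pow_eq_pow_iff_modEq, hw] at h
    have := (pow_eq_pow_iff_modEq (G := Abelianization H) (x := g)).2 (h.of_dvd (Monoid.order_dvd_exponent g))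
    rwa [pow_one] at this
  let χ : H →* Kˣ := MonoidHom.toHomUnits (φ.toMonoidHom.comp (MonoidAlgebra.of F H))
  have hχ : ∀ h, φ (MonoidAlgebra.single h 1) ^ Nat.card F ^ t = φ (MonoidAlgebra.single h 1) := by
    intro h
    have h1 := congrArg (Abelianization.lift χ) (hall (Abelianization.of h))
    rw [map_pow, Abelianization.lift_apply_of] at h1
    exact congrArg Units.val h1
  -- This power of Frobenius fixes the image of `H`, which spans `K`; the order of Frobenius is `[K
  -- : F]`.
  have hfrob : FiniteField.frobeniusAlgHom F K ^ t = 1 := by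
    have : ((FiniteField.frobeniusAlgHom F K ^ t).comp φ) = φ := by
      refine MonoidAlgebra.algHom_ext (fun h => ?_) (Subsingleton.elim _ _)
      rw [AlgHom.comp_apply, AlgHom.coe_pow, FiniteField.coe_frobeniusAlgHom, pow_iterate,
        ← Nat.card_eq_fintype_card]
      exact hχ h
    ext y
    obtain ⟨x, rfl⟩ := hφ y
    exact DFunLike.congr_fun this x
  rw [← FiniteField.orderOf_frobeniusAlgHom]
  exact Nat.le_of_dvd hpos (orderOf_dvd_of_pow_eq_one hfrob)

/-- For `D < C` with complement `E`, the modular law gives `C = D ⊕ (E ⊓ C)`. The components `f`,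
`g` of `e` are orthogonal idempotents, since for instance `f g = f - f f` lies in `D ⊓ E`. If `f =
0` then `C ≤ E` and `D = ⊥`; if `g = 0` then `C ≤ D`, a contradiction. -/
theorem IsPrimitiveIdempotent.isSimpleModule {A : Type*} [Ring A] [IsSemisimpleRing A] {e : A}
    (he : IsPrimitiveIdempotent e) : IsSimpleModule A (Ideal.span {e} : Ideal A) := by
  obtain ⟨h1, h2, h3⟩ := he
  rw [isSimpleModule_iff_isAtom]
  refine ⟨fun h => h2 ?_, fun D hD => ?_⟩
  · rw [← Ideal.span_singleton_eq_bot]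
    exact h
  obtain ⟨E, hE⟩ := exists_isCompl D
  set C : Ideal A := Ideal.span {e}
  have hsup : D ⊔ E ⊓ C = C := by
    rw [sup_inf_assoc_of_le _ hD.le |>.symm, hE.sup_eq_top, top_inf_eq]
  have heC : e ∈ C := Ideal.mem_span_singleton_self e
  obtain ⟨f, hf, g, ⟨hgE, hgC⟩, hfg⟩ := Submodule.mem_sup.1 (hsup.symm ▸ heC)
  have hzero : ∀ x, x ∈ D → x ∈ E → x = 0 := fun x hx hx' => by
    have : x ∈ D ⊓ E := ⟨hx, hx'⟩
    rwa [hE.inf_eq_bot, Submodule.mem_bot] at this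
  have hfe : f * e = f := (mem_span_idempotent_iff h1).1 (hD.le hf)
  have hge : g * e = g := (mem_span_idempotent_iff h1).1 hgC
  have hf2 : f * f + f * g = f := by rw [← mul_add, hfg, hfe]
  have hg2 : g * f + g * g = g := by rw [← mul_add, hfg, hge]
  have hfg0 : f * g = 0 := hzero _
    (by rw [eq_sub_of_add_eq' hf2]; exact D.sub_mem hf (Ideal.mul_mem_left D _ hf))
    (Ideal.mul_mem_left E _ hgE)
  have hgf0 : g * f = 0 := hzero _ (Ideal.mul_mem_left D _ hf)
    (by rw [eq_sub_of_add_eq hg2]; exact E.sub_mem hgE (Ideal.mul_mem_left E _ hgE))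
  rw [hfg0, add_zero] at hf2
  rw [hgf0, zero_add] at hg2
  rcases h3 f g hf2 hg2 hfg0 hgf0 hfg.symm with rfl | rfl
  · rw [zero_add] at hfg
    rw [eq_bot_iff]
    intro x hx
    refine (Submodule.mem_bot A).2 (hzero x hx ?_)
    rw [← (mem_span_idempotent_iff h1).1 (hD.le hx), ← hfg]
    exact Ideal.mul_mem_left E _ hgE
  · rw [add_zero] at hfg
    exact absurd ((Ideal.span_singleton_le_iff_mem D).2 (hfg ▸ hf)) (not_le_of_gt hD)

theorem IsPrimitiveIdempotent.hasScalarCorner {H : Type v} [Group H] [IsSemisimpleRing F[H]]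
    (hsplit : IsSplittingFieldFor F H) {e : F[H]} (he : IsPrimitiveIdempotent e) :
    HasScalarCorner F e := by
  intro y hy
  have hey : e * y = y := by rw [← hy, ← mul_assoc, ← mul_assoc, he.1.eq]
  have hye : y ∈ (Ideal.span {e} : Ideal F[H]) := by
    rw [← hy]
    exact Ideal.mul_mem_left _ _ (Ideal.mem_span_singleton_self e)
  -- Right multiplication by `y` is an endomorphism of the simple module, hence a scalar; evaluating
  -- at `e` identifies `y`.
  let φ : (Ideal.span {e} : Ideal F[H]) →ₗ[F[H]] (Ideal.span {e} : Ideal F[H]) :=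
    ((LinearMap.toSpanSingleton F[H] F[H] y).comp (Submodule.subtype _)).codRestrict _
      fun x => Ideal.mul_mem_left _ _ hye
  obtain ⟨c, hc⟩ := hsplit _ he.isSimpleModule φ
  refine ⟨c, ?_⟩
  have := congrArg Subtype.val (hc ⟨e, Ideal.mem_span_singleton_self e⟩)
  change e * y = algebraMap F F[H] c * e at this
  rw [hey] at this
  rw [this, Algebra.smul_def]

end Semisimple

end GroupCode

namespace GroupCode

/-! ### Recovering dimensions from residues. -/

theorem leastResidue_mulCard {F : Type*} [Field F] (p : ℕ) [CharP F p] {H : Type*} [Group H]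
    [Finite H] {e : F[H]} (he : IsIdempotentElem e) :
    leastResidue ((Nat.card H : F) * coeffOne e) =
      Module.finrank F (Ideal.span {e} : Ideal F[H]) % p := by
  rw [← natCast_finrank_span he, leastResidue_natCast p]

theorem cast_leastResidue_mulCard {F : Type*} [Field F] (p : ℕ) [CharP F p] {H : Type*} [Group H]
    [Finite H] {e : F[H]} (he : IsIdempotentElem e) :
    (leastResidue ((Nat.card H : F) * coeffOne e) : F) = (Nat.card H : F) * coeffOne e := by
  rw [leastResidue_mulCard p he, ← natCast_finrank_span he, CharP.natCast_eq_natCast F p]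
  exact Nat.mod_modEq _ p

theorem IsECID.finrank_le {F : Type u} [Field F] (p : ℕ) [CharP F p] {H : Type v} [Group H]
    (h : IsECID F H) {e : F[H]} (he : IsPrimitiveIdempotent e) :
    Module.finrank F (Ideal.span {e} : Ideal F[H]) ≤ p := by
  rw [← ringChar.eq F p]
  exact (h e he).2

theorem IsECID.finrank_eq {F : Type u} [Field F] (p : ℕ) [CharP F p] {H : Type v} [Group H]
    [Finite H] (h : IsECID F H) {e : F[H]} (he : IsPrimitiveIdempotent e) :
    Module.finrank F (Ideal.span {e} : Ideal F[H]) =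
      if leastResidue ((Nat.card H : F) * coeffOne e) = 0 then p
      else leastResidue ((Nat.card H : F) * coeffOne e) := by
  rw [leastResidue_mulCard p he.1]
  have h1 := h.finrank_le p he
  have h2 := finrank_span_pos (F := F) he.2.1
  rcases h1.lt_or_eq with h1 | h1
  · rw [Nat.mod_eq_of_lt h1, if_neg h2.ne']
  · rw [h1, Nat.mod_self, if_pos rfl]

end GroupCode

theorem theorem5p2 {F : Type u} [Field F] [Finite F] (p : ℕ) [CharP F p]
    {H : Type v} [Group H] [Finite H] [Nontrivial H]
    (C : Ideal F[H]) (hC0 : C ≠ ⊥)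
    (e : F[H]) (he : IsIdempotentElem e) (he1 : e ≠ 1) (hC : C = Ideal.span {e}) :
    (∀ r : ℕ, r = GroupCode.leastResidue ((Nat.card H : F) * GroupCode.coeffOne e) →
      (r : F) = (Nat.card H : F) * GroupCode.coeffOne e ∧
      ∃ k : ℕ, (k : ℤ) ≤ ⌊((Nat.card H : ℚ) - ((r : ℚ) + 1)) / (p : ℚ)⌋ ∧
        Module.finrank F C = r + k * p ∧
        (Nat.card H : ℚ) / ((r : ℚ) + (k : ℚ) * (p : ℚ)) ≤ (GroupCode.minDist C : ℚ)) ∧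
    (IsSemisimpleRing F[H] →
      ∀ (r s : ℕ)
        (K : Fin r → Type w₁) [∀ i, Field (K i)] [∀ i, Algebra F (K i)]
        (L : Fin s → Type w₂) [∀ j, Field (L j)] [∀ j, Algebra F (L j)]
        (n : Fin s → ℕ), (∀ j, 2 ≤ n j) →
        Nonempty (F[H] ≃ₐ[F] ((∀ i, K i) × (∀ j, Matrix (Fin (n j)) (Fin (n j)) (L j)))) →
        (∀ (w : Abelianization H) (a : ℕ),
          orderOf w = Monoid.exponent (Abelianization H) →
          0 < a →
          max (GroupCode.qOrbitSize (Nat.card F) w)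
            (Finset.univ.sup fun j => n j * Module.finrank F (L j)) ≤ a →
          (GroupCode.minDist C : ℚ) < (Nat.card H : ℚ) / (a : ℚ) →
          ¬ GroupCode.IsPrimitiveIdempotent e) ∧
        (GroupCode.IsSplittingFieldFor F H →
          (GroupCode.minDist C : ℚ) <
            (Nat.card H : ℚ) / ((max 1 (Finset.univ.sup n) : ℕ) : ℚ) →
          ¬ GroupCode.IsPrimitiveIdempotent e)) ∧
    (GroupCode.IsECID F H →
      ∀ (m : ℕ) (ε : Fin m → F[H]),
        (∀ i, GroupCode.IsPrimitiveIdempotent (ε i)) →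
        (∀ i j, i ≠ j → ε i * ε j = 0) →
        e = ∑ i, ε i →
        ∀ (r : Fin m → ℕ) (J : Finset (Fin m)),
          (∀ i, r i =
            GroupCode.leastResidue ((Nat.card H : F) * GroupCode.coeffOne (ε i))) →
          (∀ i, i ∈ J ↔ r i = 0) →
          (∀ i, (r i : F) = (Nat.card H : F) * GroupCode.coeffOne (ε i)) ∧
          Module.finrank F C = (∑ i ∈ Jᶜ, r i) + J.card * p ∧
          (Nat.card H : ℚ) / (((∑ i ∈ Jᶜ, r i) + J.card * p : ℕ) : ℚ) ≤
            (GroupCode.minDist C : ℚ)) ∧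
    (GroupCode.IsECID F H →
      (GroupCode.minDist C : ℚ) < (Nat.card H : ℚ) / (p : ℚ) →
      ¬ GroupCode.IsPrimitiveIdempotent e) := by
  classical
  subst hC
  have he0 : e ≠ 0 := fun h => hC0 (Ideal.span_singleton_eq_bot.2 h)
  have hlt := GroupCode.finrank_span_lt (F := F) he he1
  rw [GroupCode.finrank_monoidAlgebra] at hlt
  have hp : 0 < p := Nat.pos_of_ne_zero fun h => by
    subst h
    have := CharP.charP_to_charZero F
    exact not_finite F
  -- Contrapositive of the distance bound: both non-primitivity claims reduce to `dim C ≤ a`.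
  have hbound : ∀ a : ℕ, (GroupCode.minDist (Ideal.span {e} : Ideal F[H]) : ℚ) <
      (Nat.card H : ℚ) / (a : ℚ) →
      ¬ Module.finrank F (Ideal.span {e} : Ideal F[H]) ≤ a :=
    fun a h h' => absurd h (not_lt_of_ge (GroupCode.minDist_bound hC0 h'))
  refine ⟨?_, ?_, ?_, ?_⟩
  · rintro r rfl
    refine ⟨GroupCode.cast_leastResidue_mulCard p he, ?_⟩
    rw [GroupCode.leastResidue_mulCard p he]
    set d := Module.finrank F (Ideal.span {e} : Ideal F[H]) with hd
    have hdiv : d = d % p + d / p * p := by rw [mul_comm, Nat.mod_add_div]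
    generalize d % p = r at hdiv ⊢
    generalize d / p = k at hdiv ⊢
    refine ⟨k, ?_, hdiv, ?_⟩
    · rw [Int.le_floor, le_div_iff₀ (by exact_mod_cast hp), le_sub_iff_add_le]
      -- The `+ 1` is the strictness of `dim C < |H|`, which comes from `e ≠ 1`.
      have h : k * p + (r + 1) ≤ Nat.card H := by omega
      have h' : ((k * p + (r + 1) : ℕ) : ℚ) ≤ Nat.card H := Nat.cast_le.2 h
      push_cast at h' ⊢
      exact h'
    · have := GroupCode.minDist_bound hC0 (hd.symm.le.trans hdiv.le)
      exact_mod_cast this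
  · intro hss r s K _ _ L _ _ n hn ⟨φ⟩
    have hφ1 (i : Fin r) : ∃ ψ : F[H] →ₐ[F] K i, Function.Surjective ψ :=
      ⟨((Pi.evalAlgHom F K i).comp (AlgHom.fst F _ _)).comp φ.toAlgHom,
        ((Function.surjective_eval i).comp Prod.fst_surjective).comp φ.surjective⟩
    have hφ2 (j : Fin s) : ∃ ψ : F[H] →ₐ[F] Matrix (Fin (n j)) (Fin (n j)) (L j),
        Function.Surjective ψ :=
      ⟨((Pi.evalAlgHom F (fun j => Matrix (Fin (n j)) (Fin (n j)) (L j)) j).comp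
        (AlgHom.snd F (∀ i, K i) _)).comp φ.toAlgHom,
        ((Function.surjective_eval j).comp Prod.snd_surjective).comp φ.surjective⟩
    have (i : Fin r) : FiniteDimensional F (K i) := by
      obtain ⟨ψ, hψ⟩ := hφ1 i
      exact Module.Finite.of_surjective ψ.toLinearMap hψ
    have (j : Fin s) : FiniteDimensional F (L j) := by
      have : FiniteDimensional F (Matrix (Fin (n j)) (Fin (n j)) (L j)) := by
        obtain ⟨ψ, hψ⟩ := hφ2 j
        exact Module.Finite.of_surjective ψ.toLinearMap hψ
      have : NeZero (n j) := ⟨by have := hn j; omega⟩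
      exact Module.Finite.of_surjective
        (Matrix.entryLinearMap F (L j) (0 : Fin (n j)) (0 : Fin (n j)))
        fun c => ⟨Matrix.diagonal fun _ => c, by simp⟩
    have hcases (he' : GroupCode.IsPrimitiveIdempotent e) := 
      (he'.map_algEquiv φ).wedderburn_cases (F := F)
    have hle := GroupCode.finrank_span_le_map_algEquiv (F := F) e φ
    constructor
    · intro w a hw _ ha hd hprim
      refine hbound a hd (hle.trans ?_)
      rcases hcases hprim with ⟨i, hi, -⟩ | ⟨j, hj, -⟩
      · obtain ⟨ψ, hψ⟩ := hφ1 i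
        exact hi.trans ((GroupCode.finrank_field_le_qOrbitSize
          GroupCode.natCast_card_ne_zero_of_isSemisimpleRing ψ hψ w hw).trans
            ((le_max_left _ _).trans ha))
      · exact hj.trans ((Finset.le_sup (f := fun j => n j * Module.finrank F (L j))
          (Finset.mem_univ j)).trans ((le_max_right _ _).trans ha))
    · intro hsplit hd hprim
      have hcorner := (hprim.hasScalarCorner hsplit).map_algEquiv φ
      refine hbound _ hd (hle.trans ?_)
      rcases hcases hprim with ⟨i, hi, h1⟩ | ⟨j, hj, h1⟩
      · rw [h1 hcorner] at hi
        exact hi.trans (le_max_left _ _)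
      · rw [h1 hcorner, mul_one] at hj
        exact hj.trans ((Finset.le_sup (f := n) (Finset.mem_univ j)).trans (le_max_right _ _))
  · rintro hE m ε hprim horth rfl r J hr hJ
    have hdim : Module.finrank F (Ideal.span {∑ i, ε i} : Ideal F[H]) =
        (∑ i ∈ Jᶜ, r i) + J.card * p := by
      rw [(GroupCode.finrank_span_sum Finset.univ ε (fun i => (hprim i).1) horth).2,
        ← Finset.sum_compl_add_sum J, ← smul_eq_mul, ← Finset.sum_const]
      congr 1 <;> refine Finset.sum_congr rfl fun i hi => ?_
      · rw [hE.finrank_eq p (hprim i), ← hr, if_neg fun h => Finset.mem_compl.1 hi ((hJ i).2 h)]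
      · rw [hE.finrank_eq p (hprim i), ← hr, if_pos ((hJ i).1 hi)]
    refine ⟨fun i => ?_, hdim, GroupCode.minDist_bound hC0 hdim.le⟩
    rw [hr i, GroupCode.cast_leastResidue_mulCard p (hprim i).1]
  · exact fun hE hd hprim => hbound p hd (hE.finrank_le p hprim)
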